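/- Let $n\ge 0$ and $\theta\in\mathbb R$, $\theta\neq 0$. Let $\mathcal S^n$ be the Euclidean space of symmetric real $n\times n$ matrices with the Frobenius inner product $\langle\cdot,\cdot\rangle$, let $\mathcal S^n_{++}\subset\mathcal S^n$ be the open submanifold of symmetric positive definite (SPD) matrices, and let $$\phi_\theta(S)=\frac1{|\theta|}S^\theta .$$ Endow $\mathcal S^n_{++}$ with the power-Euclidean metric (PEM) $g_P(V,W)=\frac1{\theta^2}\langle(\mathrm{Pow}_\theta)_{*,P}V,(\mathrm{Pow}_\theta)_{*,P}W\rangle$, where $\mathrm{Pow}_\theta(P)=P^\theta$. The PEM-based SPD multinomial logistic regression (MLR) with parameters $P_k\in\mathcal S^n_{++}$, $A_k\in\mathcal S^n$ ($1\le k\le C$) is the classifier $p(y=k\mid S)\propto\exp\langle\phi_\theta(S)-\phi_\theta(P_k),A_k\rangle$, $S\in\mathcal S^n_{++}$. The Euclidean MLR in the codomain of $\phi_\theta$, with parameters $\bar P_k,\bar A_k\in\mathcal S^n$, is $p(y=k\mid S)\propto\exp\langle\bar A_k,\phi_\theta(S)-\bar P_k\rangle$. Then: 1. $\phi_\theta$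 is a bijection of $\mathcal S^n_{++}$ onto itself, its differential $(\phi_\theta)_{*,I}:\mathcal S^n\to\mathcal S^n$ is bijective, and the PEM-based SPD MLR is the Riemannian MLR of PEM up to this identification of the parameters: for $S,P\in\mathcal S^n_{++}$ and $A\in\mathcal S^n$, the Riemannian logarithm $\mathrm{Log}_PS$ and the parallel transport $\mathrm{PT}_{I\to P}A$ along the geodesic from $I$ to $P$ exist uniquely, and $g_P(\mathrm{Log}_PS,\mathrm{PT}_{I\to P}A)=\langle\phi_\theta(S)-\phi_\theta(P),(\phi_\theta)_{*,I}A\rangle$. 2. (Equal predictions.) If $\bar P_k=\phi_\theta(P_k)$ and $\bar A_k=A_k$ for all $k$, both classifiers give the same class probabilities at every $S\in\mathcal S^n_{++}$. 3. (Equivalent training.) Put either classifier on top of the same network with remaining parameters $w$ (in a real Hilbert space). At step $t$ there are a finite minibatch with features $F_{t,i}(w)\in\mathcal S^n_{++}$, a loss $\ell_t(w,q)$ of $w$ and of the class probabilities $q$ of the minibatch, differentiable in $q$ where all entries of $q$ are positive, and real learning rates for $w$, the $P$'s and the $A$'s, all common to both networks. In the SPD network each $P_k$ is updated by PEM-based Riemannian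 SGD, $P_k'=\mathrm{Exp}_{P_k}(-\gamma\,\mathrm{grad}_{P_k}L)$, with the Riemannian gradient and exponential map of PEM, and each $A_k$ and $w$ by Euclidean SGD; such a step exists only if all these exponentials are defined. In the Euclidean network $\bar P_k,\bar A_k,w$ are all updated by Euclidean SGD. Start the SPD network at any $w^0,P_k^0\in\mathcal S^n_{++},A_k^0$ and the Euclidean network at $w^0,\phi_\theta(P_k^0),A_k^0$. Then for every $T\ge0$: - for every Riemannian run of $T$ steps, at all times $t\le T$ one has $P_k^t\in\mathcal S^n_{++}$, $\bar w^t=w^t$, $\bar P_k^t=\phi_\theta(P_k^t)$, $\bar A_k^t=A_k^t$, and both classifiers give the same class probabilities at every $S\in\mathcal S^n_{++}$; - a Riemannian run of $T$ steps exists if and only if the Euclidean run stays in the codomain of $\phi_\theta$ up to time $T$, that is, $\bar P_k^t\in\mathcal S^n_{++}$ for all $k$ and all $t\le T$. -/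

import Mathlib

open Set

namespace PEM

/-! ### Symmetric and SPD matrices -/

attribute [local instance] Matrix.frobeniusNormedAddCommGroup Matrix.frobeniusNormedSpace

/-- The Frobenius inner product `⟨A, B⟩ = ∑ i j, A i j * B i j` on real matrices; its norm is the
Frobenius norm. -/
@[reducible] noncomputable def frobeniusInner (n : ℕ) :
    InnerProductSpace ℝ (Matrix (Fin n) (Fin n) ℝ) where
  inner A B := ∑ i, ∑ j, A i j * B i j
  norm_sq_eq_re_inner A := by
    have h : (0 : ℝ) ≤ ∑ i, ∑ j, ‖A i j‖ ^ (2 : ℝ) :=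
      Finset.sum_nonneg fun i _ => Finset.sum_nonneg fun j _ => by positivity
    rw [Matrix.frobenius_norm_def, ← Real.sqrt_eq_rpow, Real.sq_sqrt h]
    simp [pow_two]
  conj_inner_symm A B := by simp [mul_comm]
  add_left A B D := by simp [add_mul, Finset.sum_add_distrib]
  smul_left A B r := by simp [Finset.mul_sum, mul_assoc]

/-- The Euclidean space of symmetric `n × n` real matrices, with the Frobenius inner product. -/
def SymMat (n : ℕ) : Type := selfAdjoint.submodule ℝ (Matrix (Fin n) (Fin n) ℝ)

noncomputable instance (n : ℕ) : NormedAddCommGroup (SymMat n) :=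
  inferInstanceAs (NormedAddCommGroup (selfAdjoint.submodule ℝ (Matrix (Fin n) (Fin n) ℝ)))

noncomputable instance (n : ℕ) : InnerProductSpace ℝ (SymMat n) :=
  letI := frobeniusInner n
  inferInstanceAs (InnerProductSpace ℝ (selfAdjoint.submodule ℝ (Matrix (Fin n) (Fin n) ℝ)))

instance (n : ℕ) : FiniteDimensional ℝ (SymMat n) :=
  inferInstanceAs (FiniteDimensional ℝ (selfAdjoint.submodule ℝ (Matrix (Fin n) (Fin n) ℝ)))

instance (n : ℕ) : CompleteSpace (SymMat n) := FiniteDimensional.complete ℝ (SymMat n)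

/-- The set of symmetric positive definite matrices, an open subset of `SymMat n`. Its tangent
space at every point is `SymMat n`. -/
def spd (n : ℕ) : Set (SymMat n) := {S | S.1.PosDef}

/-- The identity matrix, as a symmetric matrix. -/
def idMat (n : ℕ) : SymMat n := ⟨1, IsSelfAdjoint.one _⟩

/-- The matrix power `S ^ θ`, by functional calculus (on the eigenvalues). -/
noncomputable def matPow {n : ℕ} (θ : ℝ) (S : SymMat n) : SymMat n :=
  ⟨cfc (fun x : ℝ => x ^ θ) S.1, cfc_predicate _ _⟩

/-- The map `φ_θ(S) = S ^ θ / |θ|`. -/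
noncomputable def powDeform {n : ℕ} (θ : ℝ) (S : SymMat n) : SymMat n :=
  |θ|⁻¹ • matPow θ S

/-- The power-Euclidean metric
`g_P(V, W) = θ⁻² ⟨(pow_θ)_{*,P} V, (pow_θ)_{*,P} W⟩`. -/
noncomputable def pemMetric {n : ℕ} (θ : ℝ) (P V W : SymMat n) : ℝ :=
  (θ ^ 2)⁻¹ * inner ℝ (fderiv ℝ (matPow θ) P V) (fderiv ℝ (matPow θ) P W)

end PEM

/-! ### Riemannian geometry on an open subset `M` of a Euclidean space `V`, in its global chart

A metric is given as `g : V → V → V → ℝ`, where `g P X Y` is the product of `X` and `Y` in the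
tangent space at `P`. -/

namespace Riem

variable {V : Type*} [NormedAddCommGroup V] [InnerProductSpace ℝ V]

/-- Christoffel symbols of the first kind of the Levi-Civita connection of `g`:
`Γ_P(X, Y; W) = (∂_X g(Y, W) + ∂_Y g(X, W) - ∂_W g(X, Y)) / 2`. -/
noncomputable def christoffel (g : V → V → V → ℝ) (P X Y W : V) : ℝ :=
  (fderiv ℝ (fun Q => g Q Y W) P X + fderiv ℝ (fun Q => g Q X W) P Y
    - fderiv ℝ (fun Q => g Q X Y) P W) / 2

/-- The vector field `X` along the curve `c : [0, 1] → M` with velocity `v` is parallel: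
`∇_v X = 0`. -/
def IsParallelAlong (g : V → V → V → ℝ) (c v X : ℝ → V) : Prop :=
  ∀ t ∈ Icc (0 : ℝ) 1, ∃ X' : V, HasDerivWithinAt X X' (Icc 0 1) t ∧
    ∀ W : V, g (c t) X' W + christoffel g (c t) (v t) (X t) W = 0

/-- `c : [0, 1] → M` is a geodesic with velocity `v`. -/
def IsGeodesic (g : V → V → V → ℝ) (M : Set V) (c v : ℝ → V) : Prop :=
  (∀ t ∈ Icc (0 : ℝ) 1, c t ∈ M ∧ HasDerivWithinAt c (v t) (Icc 0 1) t) ∧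
    IsParallelAlong g c v v

/-- `Exp_P X` is defined and equals `Q`; equivalently `X` is a value of the logarithm `Log_P Q`. -/
def IsExp (g : V → V → V → ℝ) (M : Set V) (P X Q : V) : Prop :=
  ∃ c v : ℝ → V, IsGeodesic g M c v ∧ c 0 = P ∧ v 0 = X ∧ c 1 = Q

/-- `B` is the parallel transport of `A` along a geodesic of `M` from `P` to `Q`. -/
def IsTransport (g : V → V → V → ℝ) (M : Set V) (P Q A B : V) : Prop :=
  ∃ c v X : ℝ → V, IsGeodesic g M c v ∧ c 0 = P ∧ c 1 = Q ∧
    IsParallelAlong g c v X ∧ X 0 = A ∧ X 1 = B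

/-- `G` is the Riemannian gradient of `f` at `P`. -/
def IsGrad (g : V → V → V → ℝ) (f : V → ℝ) (P G : V) : Prop :=
  DifferentiableAt ℝ f P ∧ ∀ X : V, g P G X = fderiv ℝ f P X

end Riem

/-! ### Multinomial logistic regression and its training -/

namespace MLR

/-- The softmax function `k ↦ exp (u k) / ∑ j, exp (u j)`. -/
noncomputable def softmax {C : ℕ} (u : Fin C → ℝ) (k : Fin C) : ℝ :=
  Real.exp (u k) / ∑ j, Real.exp (u j)

/-- The Euclidean MLR `p(y = k | x) ∝ exp ⟨a k, x - p k⟩`. -/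
noncomputable def euclMLR {V : Type*} [NormedAddCommGroup V] [InnerProductSpace ℝ V] {C : ℕ}
    (x : V) (p a : Fin C → V) : Fin C → ℝ :=
  softmax fun k => inner ℝ (a k) (x - p k)

/-- All trainable parameters of a network with an MLR head: the parameters `w` of the other layers,
and the parameters `P k` and `A k` of each class. -/
structure Params (E V : Type*) (C : ℕ) where
  w : E
  P : Fin C → V
  A : Fin C → V

variable {E V ι : Type*} [NormedAddCommGroup E] [InnerProductSpace ℝ E] [CompleteSpace E]
  [NormedAddCommGroup V] [InnerProductSpace ℝ V] [CompleteSpace V] {C : ℕ}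

/-- The loss of a minibatch (indexed by `ι`) as a function of all parameters: `F w i` is the feature
of the `i`-th sample, `head` the classifier, and `ℓ w q` the loss at the class probabilities `q`. -/
def netLoss (head : V → (Fin C → V) → (Fin C → V) → Fin C → ℝ) (F : E → ι → V)
    (ℓ : E → (ι → Fin C → ℝ) → ℝ) (z : Params E V C) : ℝ :=
  ℓ z.w fun i => head (F z.w i) z.P z.A

/-- One step of Euclidean SGD, with learning rates `γw`, `γP`, `γA`, from `z` to `z'`. -/
def IsSGDStep (L : Params E V C → ℝ) (γw γP γA : ℝ) (z z' : Params E V C) : Prop :=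
  z'.w = z.w - γw • gradient (fun w => L { z with w := w }) z.w ∧
  (∀ k, z'.P k =
    z.P k - γP • gradient (fun X => L { z with P := Function.update z.P k X }) (z.P k)) ∧
  (∀ k, z'.A k =
    z.A k - γA • gradient (fun X => L { z with A := Function.update z.A k X }) (z.A k))

/-- One training step from `z` to `z'` in which each `P k ∈ M` is updated by Riemannian SGD under
the metric `g`, `P' k = Exp_{P k} (-γP • grad)`, and the other parameters by Euclidean SGD.
No step exists if one of the exponentials is undefined. -/
def IsRSGDStep (g : V → V → V → ℝ) (M : Set V) (L : Params E V C → ℝ) (γw γP γA : ℝ)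
    (z z' : Params E V C) : Prop :=
  z'.w = z.w - γw • gradient (fun w => L { z with w := w }) z.w ∧
  (∀ k, ∃ G : V,
    Riem.IsGrad g (fun X => L { z with P := Function.update z.P k X }) (z.P k) G ∧
    Riem.IsExp g M (z.P k) (-(γP • G)) (z'.P k)) ∧
  (∀ k, z'.A k =
    z.A k - γA • gradient (fun X => L { z with A := Function.update z.A k X }) (z.A k))

end MLR

namespace PEM

/-- The PEM-based SPD MLR `p(y = k | S) ∝ exp ⟨φ_θ(S) - φ_θ(P k), A k⟩`. -/
noncomputable def pemMLR {n C : ℕ} (θ : ℝ) (S : SymMat n) (P A : Fin C → SymMat n) :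
    Fin C → ℝ :=
  MLR.softmax fun k => inner ℝ (powDeform θ S - powDeform θ (P k)) (A k)

/-- The Euclidean MLR in the codomain of `φ_θ`: it is applied to `φ_θ(S)`. -/
noncomputable def powEuclMLR {n C : ℕ} (θ : ℝ) (S : SymMat n) (P A : Fin C → SymMat n) :
    Fin C → ℝ :=
  MLR.euclMLR (powDeform θ S) P A

/-- The identification of the parameters of the two classifiers, `P k ↦ φ_θ(P k)`. -/
noncomputable def toEucl {n C : ℕ} {E : Type*} (θ : ℝ) (z : MLR.Params E (SymMat n) C) :
    MLR.Params E (SymMat n) C :=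
  { z with P := fun k => powDeform θ (z.P k) }

end PEM

/-!
The map `φ_θ` is an isometry of the SPD manifold, with the power-Euclidean metric, onto the convex
open cone of SPD matrices in the Euclidean space of symmetric matrices. Everything follows by
reading the Riemannian notions in this flat global chart.

The analytic input is that `S ↦ S ^ θ`, defined by functional calculus, is smooth on SPD matrices
(`PEM.contDiffOn_matPow`). Near an SPD matrix `S₀` (of size `n > 0`; the case `n = 0` is
trivial) choose `r = (tr S₀)⁻¹`; then `r • S₀ - 1` has
operator norm less than `1`, and on this operator norm ball `S ^ θ` is `r ^ (-θ)` times the sum of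
the binomial series in `r • S - 1`, which is analytic
(`Matrix.IsHermitian.cfc_rpow_eq_binomialSeries_sum`). The inverse of `φ_θ` is a power with
exponent `θ⁻¹` up to scaling, so it is smooth as well, and all differentials of `φ_θ` are bijective.

For a metric that is the pullback of the Euclidean one by a chart `ψ`, the Christoffel symbols are
`⟨D²ψ(X, Y), dψ W⟩`. Hence a field `X` along a curve is parallel exactly when `dψ X` is constant,
and a curve is a geodesic exactly when `ψ` maps it to a segment at constant velocity. Since the
image of the chart is convex, the exponential and the parallel transport are
`ψ (Exp_P X) = ψ P + dψ_P X` and `dψ_Q (PT_{P → Q} A) = dψ_P A`, and the former is defined exactly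
when the right-hand side lies in the image (`Riem.IsFlatChart.isExp_iff`,
`Riem.IsFlatChart.isTransport_iff`). The gradient of `f ∘ ψ` is mapped by `dψ` to the Euclidean
gradient of `f` (`Riem.IsFlatChart.isGrad_comp_iff`).

The loss of the SPD network is that of the Euclidean one composed with `φ_θ` in each class
parameter `P k`. So a Riemannian step is a Euclidean step in the chart whose endpoint stays in the
image (`PEM.isRSGDStep_iff`), and the assertion about runs follows by induction.
-/

/-! ### Riemannian manifolds with a flat global chart -/

namespace Riem

variable {V : Type*} [NormedAddCommGroup V] [InnerProductSpace ℝ V]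
  {g : V → V → V → ℝ} {M N : Set V} {ψ χ : V → V}

/-- `ψ : M → N` is a global isometry of the Riemannian manifold `(M, g)` onto the convex open
subset `N` of Euclidean space, with inverse `χ`. Twice continuous differentiability is what the
Christoffel symbols require. -/
structure IsFlatChart (g : V → V → V → ℝ) (M N : Set V) (ψ χ : V → V) : Prop where
  isOpen_source : IsOpen M
  isOpen_target : IsOpen N
  convex_target : Convex ℝ N
  contDiffOn : ContDiffOn ℝ 2 ψ M
  contDiffOn_symm : ContDiffOn ℝ 2 χ N
  mapsTo : MapsTo ψ M N
  mapsTo_symm : MapsTo χ N M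
  leftInvOn : LeftInvOn χ ψ M
  rightInvOn : RightInvOn χ ψ N
  metric_eq : ∀ P ∈ M, ∀ X Y, g P X Y = inner ℝ (fderiv ℝ ψ P X) (fderiv ℝ ψ P Y)

namespace IsFlatChart

variable (h : IsFlatChart g M N ψ χ)
include h

theorem differentiableAt {P : V} (hP : P ∈ M) : DifferentiableAt ℝ ψ P :=
  (h.contDiffOn.contDiffAt (h.isOpen_source.mem_nhds hP)).differentiableAt (by norm_num)

theorem differentiableAt_symm {Q : V} (hQ : Q ∈ N) : DifferentiableAt ℝ χ Q :=
  (h.contDiffOn_symm.contDiffAt (h.isOpen_target.mem_nhds hQ)).differentiableAt (by norm_num)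

theorem differentiableAt_fderiv {P : V} (hP : P ∈ M) : DifferentiableAt ℝ (fderiv ℝ ψ) P :=
  ((h.contDiffOn.contDiffAt (h.isOpen_source.mem_nhds hP)).fderiv_right
    (m := 1) (by norm_num)).differentiableAt (by norm_num)

theorem differentiableAt_fderiv_symm {Q : V} (hQ : Q ∈ N) :
    DifferentiableAt ℝ (fderiv ℝ χ) Q :=
  ((h.contDiffOn_symm.contDiffAt (h.isOpen_target.mem_nhds hQ)).fderiv_right
    (m := 1) (by norm_num)).differentiableAt (by norm_num)

theorem fderiv_symm_fderiv {P : V} (hP : P ∈ M) (X : V) :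
    fderiv ℝ χ (ψ P) (fderiv ℝ ψ P X) = X := by
  have h1 : fderiv ℝ (χ ∘ ψ) P = fderiv ℝ id P :=
    Filter.EventuallyEq.fderiv_eq (Filter.eventually_of_mem (h.isOpen_source.mem_nhds hP)
      fun Q hQ => h.leftInvOn hQ)
  rw [fderiv_comp _ (h.differentiableAt_symm (h.mapsTo hP)) (h.differentiableAt hP)] at h1
  simpa using congr($h1 X)

theorem fderiv_fderiv_symm {P : V} (hP : P ∈ M) (Y : V) :
    fderiv ℝ ψ P (fderiv ℝ χ (ψ P) Y) = Y := by
  have hQ := h.mapsTo hP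
  have h1 : fderiv ℝ (ψ ∘ χ) (ψ P) = fderiv ℝ id (ψ P) :=
    Filter.EventuallyEq.fderiv_eq (Filter.eventually_of_mem (h.isOpen_target.mem_nhds hQ)
      fun Q hQ => h.rightInvOn hQ)
  have h2 : DifferentiableAt ℝ ψ (χ (ψ P)) := h.differentiableAt (h.mapsTo_symm hQ)
  rw [fderiv_comp _ h2 (h.differentiableAt_symm hQ), h.leftInvOn hP] at h1
  simpa using congr($h1 Y)

theorem bijective_fderiv {P : V} (hP : P ∈ M) : Function.Bijective (fderiv ℝ ψ P) :=
  ⟨Function.LeftInverse.injective (h.fderiv_symm_fderiv hP),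
    Function.RightInverse.surjective (h.fderiv_fderiv_symm hP)⟩

/-- The terms `⟨D²ψ(X, W), dψ Y⟩` and `⟨D²ψ(Y, W), dψ X⟩` cancel in the Christoffel symbols, because
the second derivative is symmetric. -/
theorem christoffel_eq {P : V} (hP : P ∈ M) (X Y W : V) :
    christoffel g P X Y W = inner ℝ (fderiv ℝ (fderiv ℝ ψ) P X Y) (fderiv ℝ ψ P W) := by
  have hd : ∀ A B Z : V, fderiv ℝ (fun Q => g Q A B) P Z =
      inner ℝ (fderiv ℝ ψ P A) (fderiv ℝ (fderiv ℝ ψ) P Z B) +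
      inner ℝ (fderiv ℝ (fderiv ℝ ψ) P Z A) (fderiv ℝ ψ P B) := by
    intro A B Z
    have he : (fun Q => g Q A B) =ᶠ[nhds P]
        fun Q => inner ℝ (fderiv ℝ ψ Q A) (fderiv ℝ ψ Q B) :=
      Filter.eventually_of_mem (h.isOpen_source.mem_nhds hP) fun Q hQ => h.metric_eq Q hQ A B
    have hψ := (h.differentiableAt_fderiv hP).hasFDerivAt
    have hA := hψ.clm_apply (hasFDerivAt_const A P)
    have hB := hψ.clm_apply (hasFDerivAt_const B P)
    rw [he.fderiv_eq, fderiv_inner_apply ℝ hA.differentiableAt hB.differentiableAt, hA.fderiv,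
      hB.fderiv]
    simp
  have hs : IsSymmSndFDerivAt ℝ ψ P :=
    (h.contDiffOn.contDiffAt (h.isOpen_source.mem_nhds hP)).isSymmSndFDerivAt (by simp)
  rw [christoffel, hd, hd, hd, hs.eq W X, hs.eq W Y, hs.eq Y X,
    real_inner_comm (fderiv ℝ (fderiv ℝ ψ) P X W), real_inner_comm (fderiv ℝ (fderiv ℝ ψ) P Y W)]
  ring

/-- In a flat chart, a vector field is parallel exactly when its image under `dψ` is constant. -/
theorem isParallelAlong_iff {c v X : ℝ → V}
    (hc : ∀ t ∈ Icc (0 : ℝ) 1, c t ∈ M ∧ HasDerivWithinAt c (v t) (Icc 0 1) t) :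
    IsParallelAlong g c v X ↔
      ∀ t ∈ Icc (0 : ℝ) 1, fderiv ℝ ψ (c t) (X t) = fderiv ℝ ψ (c 0) (X 0) := by
  have hd : ∀ t ∈ Icc (0 : ℝ) 1, ∀ X', HasDerivWithinAt X X' (Icc 0 1) t →
      HasDerivWithinAt (fun s => fderiv ℝ ψ (c s) (X s))
        (fderiv ℝ (fderiv ℝ ψ) (c t) (v t) (X t) + fderiv ℝ ψ (c t) X') (Icc 0 1) t := by
    intro t ht X' hX'
    exact ((h.differentiableAt_fderiv (hc t ht).1).hasFDerivAt.comp_hasDerivWithinAt t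
      (hc t ht).2).clm_apply hX'
  have hg : ∀ t ∈ Icc (0 : ℝ) 1, ∀ X' W : V, g (c t) X' W + christoffel g (c t) (v t) (X t) W =
      inner ℝ (fderiv ℝ (fderiv ℝ ψ) (c t) (v t) (X t) + fderiv ℝ ψ (c t) X')
        (fderiv ℝ ψ (c t) W) := by
    intro t ht X' W
    rw [h.metric_eq _ (hc t ht).1, h.christoffel_eq (hc t ht).1, inner_add_left, add_comm]
  constructor
  · intro hX
    have h0 : ∀ t ∈ Icc (0 : ℝ) 1,
        HasDerivWithinAt (fun s => fderiv ℝ ψ (c s) (X s)) 0 (Icc 0 1) t := by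
      intro t ht
      obtain ⟨X', hX', hz⟩ := hX t ht
      obtain ⟨W, hW⟩ := (h.bijective_fderiv (hc t ht).1).2
        (fderiv ℝ (fderiv ℝ ψ) (c t) (v t) (X t) + fderiv ℝ ψ (c t) X')
      have := hz W
      rw [hg t ht, hW, inner_self_eq_zero] at this
      simpa [this] using hd t ht X' hX'
    exact constant_of_derivWithin_zero (fun t ht => (h0 t ht).differentiableWithinAt)
      fun t ht => (h0 t ⟨ht.1, ht.2.le⟩).derivWithin
        (uniqueDiffOn_Icc_zero_one t ⟨ht.1, ht.2.le⟩)
  · intro hX t ht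
    -- `X` is differentiable, since it is `dχ` along `ψ ∘ c`, applied to a constant vector.
    have hXd : DifferentiableWithinAt ℝ X (Icc 0 1) t := by
      have hQ := h.mapsTo (hc t ht).1
      have h1 : DifferentiableWithinAt ℝ (fun s => ψ (c s)) (Icc 0 1) t :=
        (h.differentiableAt (hc t ht).1).comp_differentiableWithinAt t
          (hc t ht).2.differentiableWithinAt
      have h2 : DifferentiableWithinAt ℝ (fun s => fderiv ℝ χ (ψ (c s))) (Icc 0 1) t :=
        (h.differentiableAt_fderiv_symm hQ).comp_differentiableWithinAt t h1
      have h3 := h2.clm_apply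
        (differentiableWithinAt_const (fderiv ℝ ψ (c 0) (X 0)) (s := Icc (0 : ℝ) 1))
      have he : ∀ s ∈ Icc (0 : ℝ) 1,
          X s = fderiv ℝ χ (ψ (c s)) (fderiv ℝ ψ (c 0) (X 0)) := fun s hs => by
        rw [← hX s hs, h.fderiv_symm_fderiv (hc s hs).1]
      exact DifferentiableWithinAt.congr h3 he (he t ht)
    refine ⟨_, hXd.hasDerivWithinAt, fun W => ?_⟩
    have h0 : HasDerivWithinAt (fun s => fderiv ℝ ψ (c s) (X s)) 0 (Icc 0 1) t :=
      (hasDerivWithinAt_const t (Icc (0 : ℝ) 1) (fderiv ℝ ψ (c 0) (X 0))).congr_of_mem hX ht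
    rw [hg t ht, (uniqueDiffOn_Icc_zero_one t ht).eq_deriv _ (hd t ht _ hXd.hasDerivWithinAt) h0,
      inner_zero_left]

/-- The image under `ψ` of a geodesic is a straight segment, traversed at constant velocity. -/
theorem apply_geodesic {c v : ℝ → V} (hcv : IsGeodesic g M c v) {t : ℝ} (ht : t ∈ Icc (0 : ℝ) 1) :
    ψ (c t) = ψ (c 0) + t • fderiv ℝ ψ (c 0) (v 0) := by
  have hv := (h.isParallelAlong_iff hcv.1).1 hcv.2
  have hd : ∀ s ∈ Icc (0 : ℝ) 1, HasDerivWithinAt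
      (fun s => ψ (c s) - s • fderiv ℝ ψ (c 0) (v 0)) 0 (Icc 0 1) s := by
    intro s hs
    have h1 := ((h.differentiableAt (hcv.1 s hs).1).hasFDerivAt.comp_hasDerivWithinAt s
      (hcv.1 s hs).2).sub
      ((hasDerivWithinAt_id s (Icc (0 : ℝ) 1)).smul_const (fderiv ℝ ψ (c 0) (v 0)))
    simpa [hv s hs] using! h1
  have := constant_of_derivWithin_zero (fun s hs => (hd s hs).differentiableWithinAt)
    (fun s hs => (hd s ⟨hs.1, hs.2.le⟩).derivWithin
      (uniqueDiffOn_Icc_zero_one s ⟨hs.1, hs.2.le⟩)) t ht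
  simpa [sub_eq_iff_eq_add] using this

/-- The geodesic is the preimage of a segment, which stays in the target because its endpoints do
and the target is convex. -/
theorem exists_geodesic {P Q X : V} (hP : P ∈ M) (hQ : Q ∈ M) (hX : ψ Q = ψ P + fderiv ℝ ψ P X) :
    ∃ c v : ℝ → V, IsGeodesic g M c v ∧ c 0 = P ∧ v 0 = X ∧ c 1 = Q := by
  set Y := fderiv ℝ ψ P X with hY
  have hN : ∀ t ∈ Icc (0 : ℝ) 1, ψ P + t • Y ∈ N := fun t ht =>
    h.convex_target.add_smul_mem (h.mapsTo hP) (hX ▸ h.mapsTo hQ) ht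
  have hc : ∀ t ∈ Icc (0 : ℝ) 1, χ (ψ P + t • Y) ∈ M ∧ HasDerivWithinAt
      (fun t : ℝ => χ (ψ P + t • Y)) (fderiv ℝ χ (ψ P + t • Y) Y) (Icc 0 1) t := by
    intro t ht
    refine ⟨h.mapsTo_symm (hN t ht), ?_⟩
    have h1 : HasDerivWithinAt (fun t : ℝ => ψ P + t • Y) Y (Icc 0 1) t := by
      simpa using! ((hasDerivWithinAt_id t (Icc (0 : ℝ) 1)).smul_const Y).const_add (ψ P)
    exact (h.differentiableAt_symm (hN t ht)).hasFDerivAt.comp_hasDerivWithinAt t h1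
  have hv : ∀ t ∈ Icc (0 : ℝ) 1,
      fderiv ℝ ψ (χ (ψ P + t • Y)) (fderiv ℝ χ (ψ P + t • Y) Y) = Y := by
    intro t ht
    have := h.fderiv_fderiv_symm (h.mapsTo_symm (hN t ht)) Y
    rwa [h.rightInvOn (hN t ht)] at this
  refine ⟨fun t => χ (ψ P + t • Y), fun t => fderiv ℝ χ (ψ P + t • Y) Y, ⟨hc, ?_⟩, ?_, ?_, ?_⟩
  · rw [h.isParallelAlong_iff hc]
    intro t ht
    rw [hv t ht, hv 0 (by simp)]
  · simpa using h.leftInvOn hP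
  · simpa using h.fderiv_symm_fderiv hP X
  · simpa [← hX] using h.leftInvOn hQ

theorem isExp_iff {P X Q : V} :
    IsExp g M P X Q ↔ P ∈ M ∧ Q ∈ M ∧ ψ Q = ψ P + fderiv ℝ ψ P X := by
  constructor
  · rintro ⟨c, v, hcv, rfl, rfl, rfl⟩
    refine ⟨(hcv.1 0 (by simp)).1, (hcv.1 1 (by simp)).1, ?_⟩
    simpa using h.apply_geodesic hcv (t := 1) (by simp)
  · rintro ⟨hP, hQ, hX⟩
    exact h.exists_geodesic hP hQ hX

theorem isTransport_iff {P Q A B : V} :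
    IsTransport g M P Q A B ↔ P ∈ M ∧ Q ∈ M ∧ fderiv ℝ ψ Q B = fderiv ℝ ψ P A := by
  constructor
  · rintro ⟨c, v, X, hcv, rfl, rfl, hX, rfl, rfl⟩
    exact ⟨(hcv.1 0 (by simp)).1, (hcv.1 1 (by simp)).1,
      (h.isParallelAlong_iff hcv.1).1 hX 1 (by simp)⟩
  · rintro ⟨hP, hQ, hB⟩
    obtain ⟨Z, hZ⟩ := (h.bijective_fderiv hP).2 (ψ Q - ψ P)
    obtain ⟨c, v, hcv, rfl, -, rfl⟩ := h.exists_geodesic hP hQ (X := Z) (by rw [hZ]; abel)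
    refine ⟨c, v, fun t => fderiv ℝ χ (ψ (c t)) (fderiv ℝ ψ (c 0) A), hcv, rfl, rfl, ?_, ?_, ?_⟩
    · rw [h.isParallelAlong_iff hcv.1]
      intro t ht
      rw [h.fderiv_fderiv_symm (hcv.1 t ht).1, h.fderiv_fderiv_symm hP]
    · exact h.fderiv_symm_fderiv hP A
    · simp only [← hB]
      exact h.fderiv_symm_fderiv hQ B

theorem existsUnique_isExp {P Q : V} (hP : P ∈ M) (hQ : Q ∈ M) : ∃! X, IsExp g M P X Q := by
  obtain ⟨X, hX⟩ := (h.bijective_fderiv hP).2 (ψ Q - ψ P)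
  refine ⟨X, h.isExp_iff.2 ⟨hP, hQ, by rw [hX]; abel⟩, fun Y hY => ?_⟩
  apply (h.bijective_fderiv hP).1
  rw [hX, (h.isExp_iff.1 hY).2.2]
  abel

theorem existsUnique_isTransport {P Q : V} (hP : P ∈ M) (hQ : Q ∈ M) (A : V) :
    ∃! B, IsTransport g M P Q A B := by
  obtain ⟨B, hB⟩ := (h.bijective_fderiv hQ).2 (fderiv ℝ ψ P A)
  refine ⟨B, h.isTransport_iff.2 ⟨hP, hQ, hB⟩, fun Y hY => (h.bijective_fderiv hQ).1 ?_⟩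
  rw [hB, (h.isTransport_iff.1 hY).2.2]

/-- The inner product of a logarithm and a parallel transport, computed in the flat chart. -/
theorem metric_log_transport {O P Q X A B : V} (hX : IsExp g M P X Q)
    (hB : IsTransport g M O P A B) :
    g P X B = inner ℝ (ψ Q - ψ P) (fderiv ℝ ψ O A) := by
  obtain ⟨hP, -, hX⟩ := h.isExp_iff.1 hX
  rw [h.metric_eq P hP, (h.isTransport_iff.1 hB).2.2, hX, add_sub_cancel_left]

/-- The Riemannian gradient of `f ∘ ψ` is the Euclidean gradient of `f`, pulled back by `dψ`. -/
theorem isGrad_comp_iff [CompleteSpace V] {f : V → ℝ} {P G : V} (hP : P ∈ M)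
    (hf : DifferentiableAt ℝ f (ψ P)) :
    IsGrad g (fun X => f (ψ X)) P G ↔ fderiv ℝ ψ P G = gradient f (ψ P) := by
  have hd : HasFDerivAt (fun X => f (ψ X)) ((fderiv ℝ f (ψ P)).comp (fderiv ℝ ψ P)) P :=
    hf.hasFDerivAt.comp P (h.differentiableAt hP).hasFDerivAt
  have hi : ∀ Y, fderiv ℝ f (ψ P) Y = inner ℝ (gradient f (ψ P)) Y := by
    simp [gradient]
  rw [IsGrad, hd.fderiv]
  simp only [hd.differentiableAt, true_and, h.metric_eq P hP, ContinuousLinearMap.comp_apply, hi]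
  refine ⟨fun hG => ?_, fun hG X => by rw [hG]⟩
  refine ext_inner_right ℝ fun Y => ?_
  obtain ⟨X, rfl⟩ := (h.bijective_fderiv hP).2 Y
  exact hG X

end IsFlatChart

end Riem

/-! ### The binomial series for powers of symmetric matrices -/

theorem mem_eball_zero_one_iff {E : Type*} [SeminormedAddCommGroup E] {x : E} :
    x ∈ Metric.eball (0 : E) 1 ↔ ‖x‖ < 1 := by
  rw [← ENNReal.ofReal_one, Metric.eball_ofReal, mem_ball_zero_iff]

namespace Matrix

open scoped Matrix.Norms.L2Operator

variable {n : ℕ}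

/-- The eigenvalues enter a Hermitian matrix linearly: the matrix with the eigenbasis of `A` and the
eigenvalues `d`. -/
noncomputable def IsHermitian.conjDiagonal {A : Matrix (Fin n) (Fin n) ℝ} (hA : A.IsHermitian) :
    (Fin n → ℝ) →ₐ[ℝ] Matrix (Fin n) (Fin n) ℝ :=
  ((Unitary.conjStarAlgAut ℝ _ hA.eigenvectorUnitary).toAlgEquiv.toAlgHom).comp
    (diagonalAlgHom ℝ)

namespace IsHermitian

variable {A : Matrix (Fin n) (Fin n) ℝ} (hA : A.IsHermitian)

theorem conjDiagonal_eigenvalues : hA.conjDiagonal hA.eigenvalues = A := by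
  conv_rhs => rw [hA.spectral_theorem]
  rfl

theorem cfc_eq_conjDiagonal (f : ℝ → ℝ) : cfc f A = hA.conjDiagonal (f ∘ hA.eigenvalues) := by
  rw [hA.cfc_eq]
  rfl

theorem norm_conjDiagonal (d : Fin n → ℝ) : ‖hA.conjDiagonal d‖ = ‖d‖ := by
  have h : hA.conjDiagonal d = hA.eigenvectorUnitary * diagonal d *
      (star hA.eigenvectorUnitary : unitary (Matrix (Fin n) (Fin n) ℝ)) := rfl
  rw [h, CStarRing.norm_mul_coe_unitary, CStarRing.norm_coe_unitary_mul, l2_opNorm_diagonal]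

theorem continuous_conjDiagonal : Continuous hA.conjDiagonal :=
  hA.conjDiagonal.toLinearMap.continuous_of_finiteDimensional

/-- Rescaling and recentring `A` acts on the eigenvalues alone. -/
theorem smul_sub_one_eq_conjDiagonal (r : ℝ) :
    r • A - 1 = hA.conjDiagonal (fun i => r * hA.eigenvalues i - 1) := by
  conv_lhs => rw [← hA.conjDiagonal_eigenvalues]
  rw [← map_smul, ← map_one hA.conjDiagonal, ← map_sub]
  rfl

end IsHermitian

theorem hasFPowerSeriesOnBall_binomialSeries_sum [NeZero n] (θ : ℝ) :
    HasFPowerSeriesOnBall (binomialSeries (Matrix (Fin n) (Fin n) ℝ) θ).sum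
      (binomialSeries (Matrix (Fin n) (Fin n) ℝ) θ) 0 1 := by
  have h : 1 ≤ (binomialSeries (Matrix (Fin n) (Fin n) ℝ) θ).radius :=
    (binomialSeries_radius_ge_one (𝔸 := ℝ) (a := θ)).trans
      (FormalMultilinearSeries.radius_le_of_le fun k => by
        simp [binomialSeries])
  exact (FormalMultilinearSeries.hasFPowerSeriesOnBall _
    (zero_lt_one.trans_le h)).mono zero_lt_one h

/-- The eigenvalues of a symmetric matrix in the operator norm ball of radius `r⁻¹` around
`r⁻¹ • 1` are positive. -/
theorem IsHermitian.posDef_of_norm_smul_sub_one_lt {A : Matrix (Fin n) (Fin n) ℝ}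
    (hA : A.IsHermitian) {r : ℝ} (hr : 0 < r) (h : ‖r • A - 1‖ < 1) : A.PosDef := by
  rw [hA.posDef_iff_eigenvalues_pos]
  intro i
  rw [hA.smul_sub_one_eq_conjDiagonal, hA.norm_conjDiagonal] at h
  have h1 := (abs_lt.1 ((norm_le_pi_norm (fun i => r * hA.eigenvalues i - 1) i).trans_lt h)).1
  exact pos_of_mul_pos_right (by linarith) hr.le

/-- On the operator norm ball of radius `r⁻¹` around `r⁻¹ • 1`, the power `A ^ θ` is the sum of a
binomial series in `r • A - 1`. -/
theorem IsHermitian.cfc_rpow_eq_binomialSeries_sum [NeZero n] {A : Matrix (Fin n) (Fin n) ℝ}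
    (hA : A.IsHermitian) (θ : ℝ) {r : ℝ} (hr : 0 < r) (h : ‖r • A - 1‖ < 1) :
    cfc (fun x : ℝ => x ^ θ) A =
      (r ^ θ)⁻¹ • (binomialSeries (Matrix (Fin n) (Fin n) ℝ) θ).sum (r • A - 1) := by
  have hs := (hasFPowerSeriesOnBall_binomialSeries_sum (n := n) θ).hasSum (y := r • A - 1)
    (mem_eball_zero_one_iff.2 h)
  have hpos := hA.posDef_iff_eigenvalues_pos.1 (hA.posDef_of_norm_smul_sub_one_lt hr h)
  rw [hA.smul_sub_one_eq_conjDiagonal] at hs h ⊢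
  rw [hA.norm_conjDiagonal] at h
  set d : Fin n → ℝ := fun i => r * hA.eigenvalues i - 1 with hd
  have hd1 : HasSum (fun k => Ring.choose θ k • d ^ k) (fun i => (1 + d i) ^ θ) := by
    rw [Pi.hasSum]
    intro i
    have hi : ‖d i‖ < 1 := (norm_le_pi_norm d i).trans_lt h
    have h1 := Real.one_add_rpow_hasFPowerSeriesOnBall_zero (a := θ).hasSum (y := d i)
      (mem_eball_zero_one_iff.2 hi)
    simp only [binomialSeries_apply, List.ofFn_const, List.prod_replicate, zero_add] at h1
    exact h1
  have hd2 := hd1.map hA.conjDiagonal hA.continuous_conjDiagonal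
  have he : (hA.conjDiagonal ∘ fun k => Ring.choose θ k • d ^ k) =
      fun k => binomialSeries (Matrix (Fin n) (Fin n) ℝ) θ k fun _ => hA.conjDiagonal d := by
    ext1 k
    simp
  rw [he] at hd2
  rw [zero_add] at hs
  rw [hs.unique hd2, hA.cfc_eq_conjDiagonal, ← map_smul]
  congr 1
  ext i
  have hne : r ^ θ ≠ 0 := (Real.rpow_pos_of_pos hr θ).ne'
  simp [hd, Real.mul_rpow hr.le (hpos i).le, hne]

/-- A positive definite matrix lies in an operator norm ball of the above kind, with `r⁻¹` its
trace. -/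
theorem PosDef.exists_norm_smul_sub_one_lt [NeZero n] {A : Matrix (Fin n) (Fin n) ℝ}
    (hA : A.PosDef) : ∃ r : ℝ, 0 < r ∧ ‖r • A - 1‖ < 1 := by
  have hs : 0 < ∑ i, hA.1.eigenvalues i :=
    Finset.sum_pos (fun i _ => hA.eigenvalues_pos i) Finset.univ_nonempty
  refine ⟨(∑ i, hA.1.eigenvalues i)⁻¹, inv_pos.2 hs, ?_⟩
  rw [hA.1.smul_sub_one_eq_conjDiagonal, hA.1.norm_conjDiagonal, pi_norm_lt_iff one_pos]
  intro i
  have h1 : hA.1.eigenvalues i ≤ ∑ i, hA.1.eigenvalues i :=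
    Finset.single_le_sum (fun i _ => (hA.eigenvalues_pos i).le) (Finset.mem_univ i)
  have h2 := mul_pos (inv_pos.2 hs) (hA.eigenvalues_pos i)
  have h3 : (∑ i, hA.1.eigenvalues i)⁻¹ * hA.1.eigenvalues i ≤ 1 := by
    rw [inv_mul_le_iff₀ hs]
    simpa using h1
  rw [Real.norm_eq_abs, abs_lt]
  constructor <;> linarith

end Matrix

/-! ### Powers of SPD matrices -/

namespace PEM

variable {n : ℕ}

theorem SymMat.isHermitian (S : SymMat n) : S.1.IsHermitian := S.2

theorem matPow_val (θ : ℝ) (S : SymMat n) : (matPow θ S).1 = cfc (fun x : ℝ => x ^ θ) S.1 := rfl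

theorem spectrum_pos {S : SymMat n} (hS : S ∈ spd n) {x : ℝ} (hx : x ∈ spectrum ℝ S.1) :
    0 < x := by
  rw [S.isHermitian.spectrum_real_eq_range_eigenvalues] at hx
  obtain ⟨i, rfl⟩ := hx
  exact S.isHermitian.posDef_iff_eigenvalues_pos.1 hS i

theorem mem_spd_iff {S : SymMat n} : S ∈ spd n ↔ ∀ x ∈ spectrum ℝ S.1, 0 < x := by
  refine ⟨fun hS x hx => spectrum_pos hS hx, fun h => ?_⟩
  refine S.isHermitian.posDef_iff_eigenvalues_pos.2 fun i => h _ ?_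
  exact S.isHermitian.eigenvalues_mem_spectrum_real i

theorem continuousOn_rpow_spectrum (θ : ℝ) {S : SymMat n} (hS : S ∈ spd n) :
    ContinuousOn (fun x : ℝ => x ^ θ) (spectrum ℝ S.1) :=
  continuousOn_id.rpow_const fun _ hx => Or.inl (spectrum_pos hS hx).ne'

theorem matPow_mem (θ : ℝ) {S : SymMat n} (hS : S ∈ spd n) : matPow θ S ∈ spd n := by
  refine mem_spd_iff.2 fun y hy => ?_
  obtain ⟨x, hx, rfl⟩ := (cfc_map_spectrum (fun x : ℝ => x ^ θ) S.1 S.isHermitian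
    (continuousOn_rpow_spectrum θ hS)).subset hy
  exact Real.rpow_pos_of_pos (spectrum_pos hS hx) θ

theorem matPow_matPow {θ η : ℝ} (h : θ * η = 1) {S : SymMat n} (hS : S ∈ spd n) :
    matPow η (matPow θ S) = S := by
  apply Subtype.ext
  have h1 : ContinuousOn (fun x : ℝ => x ^ η) ((fun x : ℝ => x ^ θ) '' spectrum ℝ S.1) := by
    refine continuousOn_id.rpow_const ?_
    rintro _ ⟨x, hx, rfl⟩
    exact Or.inl (Real.rpow_pos_of_pos (spectrum_pos hS hx) θ).ne'
  have h2 : EqOn ((fun x : ℝ => x ^ η) ∘ fun x => x ^ θ) id (spectrum ℝ S.1) := fun x hx => by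
    simp [← Real.rpow_mul (spectrum_pos hS hx).le, h]
  exact (cfc_comp _ _ S.1 S.isHermitian h1 (continuousOn_rpow_spectrum θ hS)).symm.trans
    ((cfc_congr h2).trans (cfc_id ℝ S.1 S.isHermitian))

section Smooth

open scoped Matrix.Norms.L2Operator

/-- The inclusion of the symmetric matrices, with the Frobenius norm, into all matrices, with the
operator norm. -/
noncomputable def SymMat.val (n : ℕ) : SymMat n →L[ℝ] Matrix (Fin n) (Fin n) ℝ :=
  LinearMap.toContinuousLinearMap
    { toFun := fun S => S.1
      map_add' := fun _ _ => rfl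
      map_smul' := fun _ _ => rfl }

theorem SymMat.val_apply (S : SymMat n) : SymMat.val n S = S.1 := rfl

theorem SymMat.exists_leftInverse_val (n : ℕ) :
    ∃ p : Matrix (Fin n) (Fin n) ℝ →L[ℝ] SymMat n, ∀ S, p S.1 = S := by
  obtain ⟨p, hp⟩ := LinearMap.exists_leftInverse_of_injective (SymMat.val n).toLinearMap
    (LinearMap.ker_eq_bot.2 fun S T h => Subtype.ext h)
  exact ⟨LinearMap.toContinuousLinearMap p, fun S => LinearMap.congr_fun hp S⟩

theorem isOpen_ball_smul_sub_one (n : ℕ) (r : ℝ) : IsOpen {S : SymMat n | ‖r • S.1 - 1‖ < 1} :=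
  isOpen_lt (((SymMat.val n).continuous.const_smul r).sub continuous_const).norm continuous_const

theorem isOpen_spd (n : ℕ) : IsOpen (spd n) := by
  rcases Nat.eq_zero_or_pos n with rfl | hn
  · convert isOpen_univ
    exact eq_univ_of_forall fun S => mem_spd_iff.2 fun x hx => by
      simp [spectrum.of_subsingleton] at hx
  have : NeZero n := ⟨hn.ne'⟩
  refine isOpen_iff_mem_nhds.2 fun S hS => ?_
  obtain ⟨r, hr, h⟩ := Matrix.PosDef.exists_norm_smul_sub_one_lt (A := S.1) hS
  exact Filter.mem_of_superset ((isOpen_ball_smul_sub_one n r).mem_nhds h)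
    fun T hT => T.isHermitian.posDef_of_norm_smul_sub_one_lt hr hT

theorem contDiffOn_matPow (n : ℕ) (θ : ℝ) : ContDiffOn ℝ 2 (matPow (n := n) θ) (spd n) := by
  rcases Nat.eq_zero_or_pos n with rfl | hn
  · have : Subsingleton (SymMat 0) := ⟨fun S T => Subtype.ext (Subsingleton.elim _ _)⟩
    exact contDiff_of_subsingleton.contDiffOn
  have : NeZero n := ⟨hn.ne'⟩
  obtain ⟨p, hp⟩ := SymMat.exists_leftInverse_val n
  intro S hS
  obtain ⟨r, hr, h⟩ := Matrix.PosDef.exists_norm_smul_sub_one_lt (A := S.1) hS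
  have he : matPow (n := n) θ =ᶠ[nhds S] fun T => p ((r ^ θ)⁻¹ •
      (binomialSeries (Matrix (Fin n) (Fin n) ℝ) θ).sum (r • SymMat.val n T - 1)) := by
    filter_upwards [(isOpen_ball_smul_sub_one n r).mem_nhds h] with T hT
    rw [SymMat.val_apply, ← T.isHermitian.cfc_rpow_eq_binomialSeries_sum θ hr hT, ← matPow_val, hp]
  have ha : AnalyticAt ℝ (binomialSeries (Matrix (Fin n) (Fin n) ℝ) θ).sum
      (r • SymMat.val n S - 1) :=
    (Matrix.hasFPowerSeriesOnBall_binomialSeries_sum θ).analyticAt_of_mem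
      (mem_eball_zero_one_iff.2 h)
  have hc : ContDiffAt ℝ 2 (fun T => r • SymMat.val n T - 1) S :=
    ((SymMat.val n).contDiff.contDiffAt.const_smul r).sub contDiffAt_const
  refine (ContDiffAt.congr_of_eventuallyEq ?_ he).contDiffWithinAt
  exact p.contDiff.contDiffAt.comp S ((ha.contDiffAt.comp S hc).const_smul _)

end Smooth

end PEM

/-! ### The flat chart of the power-Euclidean metric -/

namespace PEM

variable {n : ℕ}

theorem smul_mem_spd {S : SymMat n} (hS : S ∈ spd n) {r : ℝ} (hr : 0 < r) : r • S ∈ spd n :=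
  Matrix.PosDef.smul (x := S.1) hS hr

theorem convex_spd (n : ℕ) : Convex ℝ (spd n) :=
  convex_iff_forall_pos.2 fun S hS T hT _ _ ha hb _ =>
    Matrix.PosDef.add (A := (_ • S : SymMat n).1) (B := (_ • T : SymMat n).1)
      (smul_mem_spd hS ha) (smul_mem_spd hT hb)

/-- `φ_θ` is an isometry of the SPD manifold with the power-Euclidean metric onto the convex cone of
SPD matrices with the Euclidean metric. -/
theorem isFlatChart_powDeform {θ : ℝ} (hθ : θ ≠ 0) (n : ℕ) :
    Riem.IsFlatChart (pemMetric (n := n) θ) (spd n) (spd n) (powDeform θ)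
      (fun T => matPow θ⁻¹ (|θ| • T)) where
  isOpen_source := isOpen_spd n
  isOpen_target := isOpen_spd n
  convex_target := convex_spd n
  contDiffOn := (contDiffOn_matPow n θ).const_smul _
  contDiffOn_symm := (contDiffOn_matPow n θ⁻¹).comp (contDiff_const_smul |θ|).contDiffOn
    fun _ hT => smul_mem_spd hT (abs_pos.2 hθ)
  mapsTo _ hS := smul_mem_spd (matPow_mem θ hS) (inv_pos.2 (abs_pos.2 hθ))
  mapsTo_symm _ hT := matPow_mem θ⁻¹ (smul_mem_spd hT (abs_pos.2 hθ))
  leftInvOn S hS := by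
    simp only [powDeform]
    rw [smul_inv_smul₀ (abs_ne_zero.2 hθ), matPow_matPow (mul_inv_cancel₀ hθ) hS]
  rightInvOn T hT := by
    simp only [powDeform]
    rw [matPow_matPow (inv_mul_cancel₀ hθ) (smul_mem_spd hT (abs_pos.2 hθ)),
      inv_smul_smul₀ (abs_ne_zero.2 hθ)]
  metric_eq P hP X Y := by
    have hd : DifferentiableAt ℝ (matPow θ) P :=
      ((contDiffOn_matPow n θ).contDiffAt ((isOpen_spd n).mem_nhds hP)).differentiableAt
        (by norm_num)
    have h : fderiv ℝ (powDeform θ) P = |θ|⁻¹ • fderiv ℝ (matPow θ) P := fderiv_const_smul hd |θ|⁻¹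
    rw [h, pemMetric, FunLike.coe_smul, Pi.smul_apply, Pi.smul_apply, real_inner_smul_left,
      real_inner_smul_right, ← mul_assoc, ← mul_inv, abs_mul_abs_self, sq]

theorem idMat_mem_spd (n : ℕ) : idMat n ∈ spd n := Matrix.PosDef.one

end PEM

/-! ### Training in the chart -/

namespace MLR

variable {C : ℕ}

theorem softmax_pos [NeZero C] (u : Fin C → ℝ) (k : Fin C) : 0 < softmax u k :=
  div_pos (Real.exp_pos _) (Finset.sum_pos (fun _ _ => Real.exp_pos _) Finset.univ_nonempty)

theorem differentiable_softmax [NeZero C] : Differentiable ℝ (softmax (C := C)) := by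
  refine differentiable_pi.2 fun k => ?_
  have h1 : Differentiable ℝ fun u : Fin C → ℝ => Real.exp (u k) := by fun_prop
  have h2 : Differentiable ℝ fun u : Fin C → ℝ => ∑ j, Real.exp (u j) := by fun_prop
  simp only [softmax, div_eq_mul_inv]
  exact h1.mul (h2.fun_inv fun u =>
    (Finset.sum_pos (fun _ _ => Real.exp_pos _) Finset.univ_nonempty).ne')

/-- The loss of the Euclidean network is differentiable in each `P k`, since the class probabilities
are positive. -/
theorem differentiableAt_netLoss_update {E V ι : Type*} [Fintype ι]
    [NormedAddCommGroup V] [InnerProductSpace ℝ V] (f : V → V) (F : E → ι → V)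
    {ℓ : E → (ι → Fin C → ℝ) → ℝ}
    (hℓ : ∀ w q, (∀ i k, 0 < q i k) → DifferentiableAt ℝ (ℓ w) q) (z : Params E V C) (k : Fin C)
    (X : V) :
    DifferentiableAt ℝ (fun X => netLoss (fun x => euclMLR (f x)) F ℓ
      { z with P := Function.update z.P k X }) X := by
  have : NeZero C := ⟨k.pos.ne'⟩
  have hu : Differentiable ℝ fun X => Function.update z.P k X := by
    refine differentiable_pi.2 fun j => ?_
    rcases eq_or_ne j k with rfl | hj
    · simp
    · simp [hj]
  have hj : ∀ j, Differentiable ℝ fun X => Function.update z.P k X j :=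
    fun j => differentiable_pi.1 hu j
  have hq : Differentiable ℝ fun X => fun i : ι =>
      euclMLR (f (F z.w i)) (Function.update z.P k X) z.A := by
    refine differentiable_pi.2 fun i =>
      differentiable_softmax.comp (differentiable_pi.2 fun j => ?_)
    exact (differentiable_const _).inner ℝ ((differentiable_const _).sub (hj j))
  exact (hℓ z.w _ fun i j => softmax_pos _ _).comp X (hq X)

end MLR

namespace PEM

open MLR

variable {n C : ℕ} {E ι : Type*}

theorem pemMLR_eq (θ : ℝ) (S : SymMat n) (P A : Fin C → SymMat n) :
    pemMLR θ S P A = powEuclMLR θ S (fun k => powDeform θ (P k)) A := by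
  simp only [pemMLR, powEuclMLR, euclMLR, real_inner_comm]

theorem netLoss_pemMLR (θ : ℝ) (F : E → ι → SymMat n) (ℓ : E → (ι → Fin C → ℝ) → ℝ)
    (z : Params E (SymMat n) C) :
    netLoss (pemMLR θ) F ℓ z = netLoss (powEuclMLR θ) F ℓ (toEucl θ z) := by
  simp only [netLoss, pemMLR_eq, toEucl]

theorem toEucl_update (θ : ℝ) (z : Params E (SymMat n) C) (k : Fin C) (X : SymMat n) :
    toEucl θ { z with P := Function.update z.P k X } =
      { toEucl θ z with P := Function.update (toEucl θ z).P k (powDeform θ X) } := by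
  simp only [toEucl, Params.mk.injEq, true_and, and_true]
  ext1 j
  exact Function.apply_update (fun _ => powDeform θ) z.P k X j

/-- On a single class parameter: the gradient and the exponential map, read in the chart `φ_θ`, are
the Euclidean ones, and the exponential is defined exactly when its endpoint lies in the image of
the chart. -/
theorem exists_isGrad_isExp_iff {θ : ℝ} (hθ : θ ≠ 0) {f : SymMat n → ℝ} {P P' : SymMat n}
    (hP : P ∈ spd n) (hf : DifferentiableAt ℝ f (powDeform θ P)) (γ : ℝ) :
    (∃ G, Riem.IsGrad (pemMetric θ) (fun X => f (powDeform θ X)) P G ∧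
      Riem.IsExp (pemMetric θ) (spd n) P (-(γ • G)) P') ↔
    P' ∈ spd n ∧ powDeform θ P' = powDeform θ P - γ • gradient f (powDeform θ P) := by
  have h := isFlatChart_powDeform hθ n
  simp only [h.isGrad_comp_iff hP hf, h.isExp_iff, map_neg, map_smul, ← sub_eq_add_neg]
  constructor
  · rintro ⟨G, hG, -, hP', he⟩
    exact ⟨hP', hG ▸ he⟩
  · rintro ⟨hP', he⟩
    obtain ⟨G, hG⟩ := (h.bijective_fderiv hP).2 (gradient f (powDeform θ P))
    exact ⟨G, hG, hP, hP', hG ▸ he⟩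

/-- A Riemannian training step is a Euclidean one, read in the chart, that ends in the image of the
chart. -/
theorem isRSGDStep_iff [NormedAddCommGroup E] [InnerProductSpace ℝ E] [CompleteSpace E] [Fintype ι]
    {θ : ℝ} (hθ : θ ≠ 0) (F : E → ι → SymMat n) {ℓ : E → (ι → Fin C → ℝ) → ℝ}
    (hℓ : ∀ w q, (∀ i k, 0 < q i k) → DifferentiableAt ℝ (ℓ w) q) (γw γP γA : ℝ)
    {z z' : Params E (SymMat n) C} (hz : ∀ k, z.P k ∈ spd n) :
    IsRSGDStep (pemMetric θ) (spd n) (netLoss (pemMLR θ) F ℓ) γw γP γA z z' ↔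
      (∀ k, z'.P k ∈ spd n) ∧
        IsSGDStep (netLoss (powEuclMLR θ) F ℓ) γw γP γA (toEucl θ z) (toEucl θ z') := by
  simp only [IsRSGDStep, IsSGDStep, netLoss_pemMLR, toEucl_update]
  have h : ∀ k, _ := fun k => exists_isGrad_isExp_iff (P' := z'.P k) hθ (hz k)
    (differentiableAt_netLoss_update (powDeform θ) F hℓ (toEucl θ z) k (powDeform θ (z.P k))) γP
  have h' := forall_congr' h
  rw [forall_and] at h'
  constructor
  · rintro ⟨hw, hP, hA⟩
    exact ⟨(h'.1 hP).1, hw, (h'.1 hP).2, hA⟩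
  · rintro ⟨hM, hw, hP, hA⟩
    exact ⟨hw, h'.2 ⟨hM, hP⟩, hA⟩

theorem isSGDStep_unique {E V : Type*} [NormedAddCommGroup E] [InnerProductSpace ℝ E]
    [CompleteSpace E] [NormedAddCommGroup V] [InnerProductSpace ℝ V] [CompleteSpace V]
    {L : Params E V C → ℝ} {γw γP γA : ℝ} {z z₁ z₂ : Params E V C}
    (h₁ : IsSGDStep L γw γP γA z z₁) (h₂ : IsSGDStep L γw γP γA z z₂) : z₁ = z₂ := by
  obtain ⟨w₁, P₁, A₁⟩ := z₁
  obtain ⟨w₂, P₂, A₂⟩ := z₂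
  simp only [Params.mk.injEq]
  exact ⟨h₁.1.trans h₂.1.symm, funext fun k => (h₁.2.1 k).trans (h₂.2.1 k).symm,
    funext fun k => (h₁.2.2 k).trans (h₂.2.2 k).symm⟩

end PEM

open PEM MLR Riem in
theorem mainTheorem3 (θ : ℝ) (hθ : θ ≠ 0) (n : ℕ) :
    -- `φ_θ` is a bijection of the SPD manifold, and its differential at `I` is an isomorphism
    Set.BijOn (powDeform θ) (spd n) (spd n) ∧
    Function.Bijective (fderiv ℝ (powDeform θ) (idMat n)) ∧
    -- the score of a class in the PEM-based SPD MLR is the Riemannian one under PEM,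
    -- `g_P (Log_P S, PT_{I → P} A)`, where `φ_{θ*,I} A` is the parameter of the classifier
    (∀ S ∈ spd n, ∀ P ∈ spd n, ∀ A : SymMat n,
      (∃! X, IsExp (pemMetric θ) (spd n) P X S) ∧
      (∃! B, IsTransport (pemMetric θ) (spd n) (idMat n) P A B) ∧
      ∀ X B, IsExp (pemMetric θ) (spd n) P X S →
        IsTransport (pemMetric θ) (spd n) (idMat n) P A B →
        pemMetric θ P X B =
          inner ℝ (powDeform θ S - powDeform θ P) (fderiv ℝ (powDeform θ) (idMat n) A)) ∧
    -- equal predictions of the two classifiers under `P k ↦ φ_θ (P k)`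
    (∀ (C : ℕ) (P A : Fin C → SymMat n), (∀ k, P k ∈ spd n) → ∀ S ∈ spd n,
      pemMLR θ S P A = powEuclMLR θ S (fun k => powDeform θ (P k)) A) ∧
    -- equivalence in training
    ∀ {E ι : Type*} [NormedAddCommGroup E] [InnerProductSpace ℝ E] [CompleteSpace E] [Fintype ι]
      (C : ℕ) (F : ℕ → E → ι → SymMat n) (_ : ∀ t w i, F t w i ∈ spd n)
      (ℓ : ℕ → E → (ι → Fin C → ℝ) → ℝ)
      (_ : ∀ t w q, (∀ i k, 0 < q i k) → DifferentiableAt ℝ (ℓ t w) q)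
      (γw γP γA : ℕ → ℝ)
      (z₀ : Params E (SymMat n) C) (_ : ∀ k, z₀.P k ∈ spd n)
      (y : ℕ → Params E (SymMat n) C) (_ : y 0 = toEucl θ z₀)
      (_ : ∀ t, IsSGDStep (netLoss (powEuclMLR θ) (F t) (ℓ t)) (γw t) (γP t) (γA t)
        (y t) (y (t + 1)))
      (T : ℕ),
      -- a Riemannian training run agrees with the Euclidean one as long as it goes on
      (∀ z : ℕ → Params E (SymMat n) C, z 0 = z₀ →
        (∀ t < T, IsRSGDStep (pemMetric θ) (spd n) (netLoss (pemMLR θ) (F t) (ℓ t))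
          (γw t) (γP t) (γA t) (z t) (z (t + 1))) →
        ∀ t ≤ T, (∀ k, (z t).P k ∈ spd n) ∧ y t = toEucl θ (z t) ∧
          ∀ S ∈ spd n, pemMLR θ S (z t).P (z t).A = powEuclMLR θ S (y t).P (y t).A) ∧
      -- and it goes on exactly as long as the Euclidean run stays in the codomain of `φ_θ`
      ((∃ z : ℕ → Params E (SymMat n) C, z 0 = z₀ ∧
        ∀ t < T, IsRSGDStep (pemMetric θ) (spd n) (netLoss (pemMLR θ) (F t) (ℓ t))
          (γw t) (γP t) (γA t) (z t) (z (t + 1))) ↔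
        ∀ t ≤ T, ∀ k, (y t).P k ∈ spd n) := by
  have h := isFlatChart_powDeform hθ n
  have hbij : BijOn (powDeform θ) (spd n) (spd n) :=
    ⟨h.mapsTo, h.leftInvOn.injOn, h.rightInvOn.surjOn h.mapsTo_symm⟩
  refine ⟨hbij, h.bijective_fderiv (idMat_mem_spd n), fun S hS P hP A => ?_,
    fun C P A _ S _ => pemMLR_eq θ S P A, ?_⟩
  · exact ⟨h.existsUnique_isExp hP hS, h.existsUnique_isTransport (idMat_mem_spd n) hP A,
      fun X B hX hB => h.metric_log_transport hX hB⟩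
  intro E ι _ _ _ _ C F _ ℓ hℓ γw γP γA z₀ hz₀ y hy₀ hy T
  have hrun : ∀ z : ℕ → Params E (SymMat n) C, z 0 = z₀ →
      (∀ t < T, IsRSGDStep (pemMetric θ) (spd n) (netLoss (pemMLR θ) (F t) (ℓ t))
        (γw t) (γP t) (γA t) (z t) (z (t + 1))) →
      ∀ t ≤ T, (∀ k, (z t).P k ∈ spd n) ∧ y t = toEucl θ (z t) := by
    intro z hz0 hz t
    induction t with
    | zero => exact fun _ => ⟨hz0 ▸ hz₀, hz0 ▸ hy₀⟩
    | succ t ih =>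
      intro ht
      obtain ⟨hM, hyt⟩ := ih (by omega)
      obtain ⟨hM', hs⟩ := (isRSGDStep_iff hθ (F t) (hℓ t) _ _ _ hM).1 (hz t (by omega))
      exact ⟨hM', isSGDStep_unique (hyt ▸ hy t) hs⟩
  refine ⟨fun z hz0 hz t ht => ?_, fun ⟨z, hz0, hz⟩ t ht k => ?_, fun hM => ?_⟩
  · obtain ⟨hM, hyt⟩ := hrun z hz0 hz t ht
    exact ⟨hM, hyt, fun S _ => by rw [hyt]; exact pemMLR_eq θ S _ _⟩
  · obtain ⟨hM, hyt⟩ := hrun z hz0 hz t ht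
    rw [hyt]
    exact h.mapsTo (hM k)
  · -- The Riemannian run is the Euclidean one, pulled back by the inverse of `φ_θ`.
    let z : ℕ → Params E (SymMat n) C := fun t =>
      { y t with P := fun k => matPow θ⁻¹ (|θ| • (y t).P k) }
    have hzM : ∀ t ≤ T, ∀ k, (z t).P k ∈ spd n := fun t ht k => h.mapsTo_symm (hM t ht k)
    have hzy : ∀ t ≤ T, toEucl θ (z t) = y t := fun t ht => by
      have hP : (fun k => powDeform θ ((z t).P k)) = (y t).P :=
        funext fun k => h.rightInvOn (hM t ht k)
      simp only [toEucl, hP]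
      rfl
    refine ⟨z, ?_, fun t ht => ?_⟩
    · have hP : (fun k => matPow θ⁻¹ (|θ| • powDeform θ (z₀.P k))) = z₀.P :=
        funext fun k => h.leftInvOn (hz₀ k)
      simp only [z, hy₀, toEucl, hP]
    · rw [isRSGDStep_iff hθ (F t) (hℓ t) _ _ _ (hzM t ht.le), hzy t ht.le, hzy (t + 1) ht]
      exact ⟨hzM (t + 1) ht, hy t⟩
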